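/- A substitution of constant length $L\ge 2$ on a finite alphabet $A$ is a map $\theta:A\to A^L$, extended to finite words by juxtaposition; it is primitive if there is an $i$ such that every letter of $A$ occurs in $\theta^i(a)$ for every $a\in A$. For $\theta$ primitive, $X_\theta\subseteq A^{\mathbb Z}$ denotes the smallest closed shift-invariant set in which every word $\theta^i(a)$, $a\in A$, $i\ge 1$, appears, and $\sigma$ denotes the left shift, $(\sigma x)_i=x_{i+1}$; $(X_\theta,\sigma)$ is called the substitution minimal system generated by $\theta$. Two systems $(X,\sigma)$ and $(Y,\sigma)$ are topologically conjugate if there is a homeomorphism $\varphi:X\to Y$ with $\varphi\circ\sigma=\sigma\circ\varphi$. **Lemma.** Let $\theta$ and $\zeta$ be primitive substitutions of constant lengths $M\ge 2$ and $N\ge 2$ (on possibly different finite alphabets) such that $X_\theta$ and $X_\zeta$ are infinite and $(X_\theta,\sigma)$ and $(X_\zeta,\sigma)$ are topologically conjugate. If $M=RN$ for an integer $R>1$, then there is a primitive substitution $\xi$ of constant length $R$ on a finite alphabet such that $(X_\xi,\sigma)$ is topologically conjugate to both $(X_\theta,\sigma)$ and $(X_\zeta,\sigma)$. -/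

import Mathlib

/-!
Constant-length substitutions, the subshifts they generate, and topological conjugacy.
Two-sided subshifts are Mathlib's `SymbolicDynamics.FullShift.Subshift A ℤ` (closed subsets of
`ℤ → A` invariant under all powers of the shift), and the left shift is
`SymbolicDynamics.FullShift.shift 1`, i.e. `x ↦ (i ↦ x (1 + i))`.
-/

namespace ConstLength

open SymbolicDynamics.FullShift

/-- A constant-length substitution `θ : A → A^L`, extended to finite words by juxtaposition. -/
def substWord {A : Type*} {L : ℕ} (θ : A → Fin L → A) (w : List A) : List A :=
  w.flatMap fun a => List.ofFn (θ a)

/-- The word `θ^i(a)`. -/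
def iterWord {A : Type*} {L : ℕ} (θ : A → Fin L → A) (i : ℕ) (a : A) : List A :=
  (substWord θ)^[i] [a]

/-- `θ` is primitive: for some `i`, every letter occurs in every `θ^i(a)`. -/
def IsPrimitive {A : Type*} {L : ℕ} (θ : A → Fin L → A) : Prop :=
  ∃ i : ℕ, ∀ a b : A, b ∈ iterWord θ i a

/-- The finite word `w` appears in (some point of) `X`. -/
def WordAppears {A : Type*} (w : List A) (X : Set (ℤ → A)) : Prop :=
  ∃ x ∈ X, ∃ m : ℤ, ∀ (j : ℕ) (hj : j < w.length), x (m + j) = w[j]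

/-- Every word `θ^i(a)`, `a ∈ A`, `i ≥ 1`, appears in the subshift `X`. -/
def ContainsWords {A : Type*} [TopologicalSpace A] {L : ℕ} (θ : A → Fin L → A)
    (X : Subshift A ℤ) : Prop :=
  ∀ (i : ℕ) (a : A), 1 ≤ i → WordAppears (iterWord θ i a) X.carrier

/-- `X_θ`: the intersection of all subshifts in which every word `θ^i(a)`, `i ≥ 1`, appears.
For `θ` primitive of length at least `2` the words `θ^i(a)` appear in `X_θ` itself, so `X_θ` is
the smallest subshift with this property: see `substSystem_containsWords` and
`substSystem_subset`. -/
def substSystem {A : Type*} [TopologicalSpace A] {L : ℕ} (θ : A → Fin L → A) :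
    Subshift A ℤ where
  carrier := {x | ∀ X : Subshift A ℤ, ContainsWords θ X → x ∈ X.carrier}
  isClosed := by
    simp only [Set.ofPred_forall]
    exact isClosed_iInter fun X => isClosed_iInter fun _ => X.isClosed
  mapsTo := fun g _ hx X hX => X.mapsTo g (hx X hX)

/-- The left shift `(σ x)_i = x_{i+1}`, as a self-map of a subshift. -/
def shiftMap {A : Type*} [TopologicalSpace A] (X : Subshift A ℤ) : X.carrier → X.carrier :=
  (X.mapsTo 1).restrict

/-- `(X, σ)` and `(Y, σ)` are topologically conjugate. -/
def Conjugate {A B : Type*} [TopologicalSpace A] [TopologicalSpace B]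
    (X : Subshift A ℤ) (Y : Subshift B ℤ) : Prop :=
  ∃ φ : X.carrier ≃ₜ Y.carrier, ∀ x : X.carrier, φ (shiftMap X x) = shiftMap Y (φ x)

theorem substSystem_subset {A : Type*} [TopologicalSpace A] {L : ℕ} (θ : A → Fin L → A)
    (X : Subshift A ℤ) (hX : ContainsWords θ X) : (substSystem θ).carrier ⊆ X.carrier :=
  fun _ hx => hx X hX

theorem substWord_iterate_append {A : Type*} {L : ℕ} (θ : A → Fin L → A) (i : ℕ)
    (u v : List A) :
    (substWord θ)^[i] (u ++ v) = (substWord θ)^[i] u ++ (substWord θ)^[i] v := by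
  induction i generalizing u v with
  | zero => rfl
  | succ i ih =>
    simp only [Function.iterate_succ, Function.comp_apply]
    rw [← ih]
    simp [substWord]

theorem length_substWord_iterate {A : Type*} {L : ℕ} (θ : A → Fin L → A) (i : ℕ)
    (u : List A) : ((substWord θ)^[i] u).length = u.length * L ^ i := by
  induction i generalizing u with
  | zero => simp
  | succ i ih =>
    simp only [Function.iterate_succ, Function.comp_apply]
    rw [ih]
    simp [substWord, pow_succ]
    ring

/-- For `θ` primitive, every word `θ^i(a)` occurs in some `θ^k(c)` far away from both ends. -/
theorem exists_padded {A : Type*} {L : ℕ} (hL : 2 ≤ L) (θ : A → Fin L → A)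
    (hθ : IsPrimitive θ) (i : ℕ) (a : A) (n : ℕ) :
    ∃ (k : ℕ) (c : A) (u v : List A), 1 ≤ k ∧ iterWord θ k c = u ++ (iterWord θ i a ++ v) ∧
      n ≤ u.length ∧ n ≤ v.length := by
  obtain ⟨p, hp⟩ := hθ
  have hp' : ∀ (m : ℕ) (b : A), a ∈ iterWord θ (p + m) b := by
    intro m b
    have hlen := length_substWord_iterate θ m [b]
    have hpos : 0 < ((substWord θ)^[m] [b]).length := by
      rw [hlen]; simp; positivity
    obtain ⟨d, r, hdr⟩ := List.exists_cons_of_length_pos hpos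
    rw [iterWord, Function.iterate_add_apply, hdr, ← List.singleton_append,
      substWord_iterate_append]
    exact List.mem_append_left _ (hp d a)
  have hlen2 := length_substWord_iterate θ 2 [a]
  have h4 : 4 ≤ ((substWord θ)^[2] [a]).length := by
    rw [hlen2]; simp; nlinarith
  obtain ⟨c0, c1, c2, r, hr⟩ : ∃ c0 c1 c2 r, (substWord θ)^[2] [a] = [c0] ++ ([c1] ++ ([c2] ++ r)) := by
    rcases h : (substWord θ)^[2] [a] with _ | ⟨c0, _ | ⟨c1, _ | ⟨c2, r⟩⟩⟩
    · simp [h] at h4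
    · simp [h] at h4
    · simp [h] at h4
    · exact ⟨c0, c1, c2, r, rfl⟩
  obtain ⟨s, t, hst⟩ := List.append_of_mem (hp' n c1)
  set q := i + (p + n) with hq
  have hbig : n ≤ L ^ q := by
    calc n ≤ 2 ^ n := Nat.lt_two_pow_self.le
      _ ≤ L ^ n := Nat.pow_le_pow_left hL n
      _ ≤ L ^ q := Nat.pow_le_pow_right (by lia) (by lia)
  have hmid : (substWord θ)^[q] [c1]
      = (substWord θ)^[i] s ++ (iterWord θ i a ++ (substWord θ)^[i] t) := by
    rw [hq, Function.iterate_add_apply]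
    change (substWord θ)^[i] (iterWord θ (p + n) c1) = _
    rw [hst, ← List.singleton_append, substWord_iterate_append, substWord_iterate_append]
    rfl
  refine ⟨q + 2, a, (substWord θ)^[q] [c0] ++ (substWord θ)^[i] s,
    (substWord θ)^[i] t ++ ((substWord θ)^[q] [c2] ++ (substWord θ)^[q] r), by lia, ?_, ?_, ?_⟩
  · rw [iterWord, Function.iterate_add_apply, hr]
    simp only [substWord_iterate_append, hmid, List.append_assoc]
  · rw [List.length_append, length_substWord_iterate θ q]
    simp; lia
  · rw [List.length_append, List.length_append, length_substWord_iterate θ q [c2]]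
    simp; lia

/-- Well-definedness of `X_θ`: for `θ` primitive, the words `θ^i(a)` do appear in `X_θ`. -/
theorem substSystem_containsWords {A : Type*} [Finite A] [TopologicalSpace A]
    [DiscreteTopology A] {L : ℕ} (hL : 2 ≤ L) (θ : A → Fin L → A) (hθ : IsPrimitive θ) :
    ContainsWords θ (substSystem θ) := by
  intro i a _
  set w := iterWord θ i a with hw
  choose k c u v hk huv hu hv using exists_padded hL θ hθ i a
  -- in every admissible subshift, `u n ++ w ++ v n` appears with `w` starting at `0`
  have key : ∀ X : Subshift A ℤ, ContainsWords θ X → ∀ n : ℕ, ∃ x ∈ X.carrier,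
      ∀ (j : ℕ) (hj : j < (u n ++ (w ++ v n)).length),
        x ((j : ℤ) - (u n).length) = (u n ++ (w ++ v n))[j] := by
    intro X hX n
    obtain ⟨x, hx, m, hm⟩ := hX (k n) (c n) (hk n)
    refine ⟨shift (m + (u n).length) x, X.mapsTo _ hx, fun j hj => ?_⟩
    have := hm j (by rw [huv]; exact hj)
    simp only [huv] at this
    rw [← this, shift_apply]
    congr 1; ring
  have hfull : ContainsWords θ (fullShift A ℤ) := by
    intro i' a' _
    refine ⟨fun z => (iterWord θ i' a').getD z.toNat a', trivial, 0, fun j hj => ?_⟩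
    simp [hj]
  choose y hy1 hy2 using key _ hfull
  let U : Ultrafilter ℕ := Filter.hyperfilter ℕ
  obtain ⟨z, -, hz⟩ := isCompact_univ.ultrafilter_le_nhds (U.map y) (by simp)
  have hz' : Filter.Tendsto y U (nhds z) := hz
  have hU : ∀ n : ℕ, ∀ᶠ m in (U : Filter ℕ), n ≤ m := fun n =>
    (Nat.cofinite_eq_atTop ▸ Filter.hyperfilter_le_cofinite (α := ℕ))
      (Filter.eventually_ge_atTop n)
  refine ⟨z, ?_, 0, fun j hj => ?_⟩
  · intro X hX
    choose x hx1 hx2 using key X hX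
    refine X.isClosed.mem_of_tendsto (f := x) (b := (U : Filter ℕ)) ?_
      (Filter.Eventually.of_forall hx1)
    rw [tendsto_pi_nhds] at hz' ⊢
    intro l
    refine (hz' l).congr' ?_
    filter_upwards [hU (l.natAbs + 1)] with n hn
    have h1 := hu n
    have h2 := hv n
    obtain ⟨j, hj⟩ : ∃ j : ℕ, (j : ℤ) = l + (u n).length :=
      ⟨(l + (u n).length).toNat, by lia⟩
    have hjl : j < (u n ++ (w ++ v n)).length := by
      simp only [List.length_append]; lia
    have e1 := hx2 n j hjl
    have e2 := hy2 n j hjl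
    rw [← e1, show (j : ℤ) - (u n).length = l by lia] at e2
    exact e2
  · rw [tendsto_pi_nhds] at hz'
    have h0 := hz' j
    have : ∀ n, y n j = w[j] := by
      intro n
      have e := hy2 n ((u n).length + j) (by simp only [List.length_append]; lia)
      simp only [List.getElem_append_right (Nat.le_add_right _ _), Nat.add_sub_cancel_left,
        List.getElem_append_left hj] at e
      rw [← e]
      congr 1; push_cast; ring
    simp only [this] at h0
    rw [zero_add]
    exact tendsto_nhds_unique h0 tendsto_const_nhds

end ConstLength

/-!
A primitive substitution of length `L` maps its subshift to itself by a continuous map that scales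
time by `L`. Transporting the map induced by `θ` along the conjugacy gives a self-map `F` of `X_ζ`
that scales time by `M = N * R`, next to the map `S` induced by `ζ`, which scales time by `N`. By
minimality the range of `F` is contained in one translate `j +ᵥ range S`, and recognizability says
that `S` is injective, so `F = j +ᵥ S ∘ g` with `g` continuous and scaling time by `R`. As `R ≥ 2`,
`g` contracts windows of coordinates: for large `s` the coordinates of `x` in `[-2s, 2s]` determine
those of each `j +ᵥ g x`, `0 ≤ j < R`, in the same window. Reading `x` through this window is thus a
conjugacy onto the subshift of a substitution of length `R`, whose primitivity comes from the
bounded gaps between visits of a minimal system to an open set.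

Recognizability is a counting argument. If the translates of `range S^k` by some `I ⊆ [0, N^k)` with
fewer than `N^k` elements covered `X`, iterating would give coverings for `S^(k * e)` by at most
`|I|^e` translates, whereas a pigeonhole argument shows that the number of translates needed is at
least a constant multiple of `N^(k * e)`. Hence the `N^k` translates of `range S^k` are pairwise
disjoint, and injectivity follows once `k` is so large that `ζ^k` and `ζ^(k + 1)` identify the same
letters.
-/

namespace ConstLength

open SymbolicDynamics.FullShift Set
open scoped Pointwise

section TimeScaling

variable {α β γ : Type*} [AddAction ℤ α] [AddAction ℤ β] [AddAction ℤ γ]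

/-- `f` scales time by `P` if it intertwines one time step of its source with `P` time steps of its
target. Scaling time by `1` is equivariance, and the map that a substitution of length `L` induces
on its subshift scales time by `L`. -/
def ScalesTime (P : ℤ) (f : α → β) : Prop :=
  ∀ (n : ℤ) (x : α), f (n +ᵥ x) = (P * n) +ᵥ f x

namespace ScalesTime

variable {P Q : ℤ}

theorem of_map_one_vadd {f : α → β} (h : ∀ x, f ((1 : ℤ) +ᵥ x) = P +ᵥ f x) : ScalesTime P f := by
  intro n x
  induction n with
  | zero => simp
  | succ n ih => rw [add_comm, add_vadd, h, ih, vadd_vadd, mul_add, mul_one]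
  | pred n ih =>
    rw [← vadd_left_cancel_iff P, ← h, vadd_vadd, vadd_vadd, add_sub_cancel, ih]
    congr 1
    ring

theorem comp {f : α → β} {g : β → γ} (hg : ScalesTime Q g) (hf : ScalesTime P f) :
    ScalesTime (Q * P) (g ∘ f) := fun n x => by
  simp only [Function.comp_apply, hf n, hg (P * n), mul_assoc]

theorem iterate {f : α → α} (hf : ScalesTime P f) (k : ℕ) : ScalesTime (P ^ k) f^[k] := by
  induction k with
  | zero => exact fun n x => by simp
  | succ k ih => simpa only [Function.iterate_succ, pow_succ] using ih.comp hf

theorem const_vadd {f : α → β} (hf : ScalesTime P f) (j : ℤ) :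
    ScalesTime P fun x => j +ᵥ f x := fun n x => by
  simp only [hf n, vadd_comm j]

theorem equiv_symm {e : α ≃ β} (he : ScalesTime 1 e) : ScalesTime 1 e.symm := fun n y => by
  rw [Equiv.symm_apply_eq, he, e.apply_symm_apply, one_mul, one_mul]

/-- Base-`P` expansions: digits from `I` in place `0` are followed by `k` further digits. -/
theorem exists_iterate_cover {f : α → α} (hf : ScalesTime P f) {I : Finset ℤ}
    (hI : I ⊆ Finset.Ico 0 P) (hcov : (I : Set ℤ) +ᵥ range f = univ) (k : ℕ) :
    ∃ J ⊆ Finset.Ico 0 (P ^ k), J.card ≤ I.card ^ k ∧ (J : Set ℤ) +ᵥ range f^[k] = univ := by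
  induction k with
  | zero => exact ⟨{0}, by simp, by simp, by simp⟩
  | succ k ih =>
    obtain ⟨J, hJ, hcard, hJcov⟩ := ih
    refine ⟨I + J.image (P * ·), fun m hm => ?_, ?_, eq_univ_of_forall fun x => ?_⟩
    · obtain ⟨i, hi, _, hPj, rfl⟩ := Finset.mem_add.1 hm
      obtain ⟨j, hj, rfl⟩ := Finset.mem_image.1 hPj
      obtain ⟨hi0, hiP⟩ := Finset.mem_Ico.1 (hI hi)
      obtain ⟨hj0, hjP⟩ := Finset.mem_Ico.1 (hJ hj)
      rw [Finset.mem_Ico, pow_succ']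
      exact ⟨by nlinarith, by nlinarith⟩
    · rw [pow_succ']
      exact Finset.card_add_le.trans (Nat.mul_le_mul le_rfl (Finset.card_image_le.trans hcard))
    · obtain ⟨i, hi, _, ⟨y, rfl⟩, rfl⟩ := mem_vadd.1 (hcov ▸ mem_univ x)
      obtain ⟨j, hj, _, ⟨z, rfl⟩, rfl⟩ := mem_vadd.1 (hJcov ▸ mem_univ y)
      refine mem_vadd.2 ⟨i + P * j, ?_, f^[k + 1] z, mem_range_self z, ?_⟩
      · exact Finset.add_mem_add hi (Finset.mem_image_of_mem _ hj)
      · rw [Function.iterate_succ_apply', hf, add_vadd]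

end ScalesTime

end TimeScaling

section MinimalSystems

variable {α β γ : Type*} [TopologicalSpace α] [AddAction ℤ α] [AddAction.IsMinimal ℤ α]
  [AddAction ℤ β] [TopologicalSpace γ] [AddAction ℤ γ]

theorem eq_univ_of_isClosed_of_vadd_mem [ContinuousConstVAdd ℤ α] {C : Set α} (hC : IsClosed C)
    (hvadd : ∀ (n : ℤ), ∀ x ∈ C, n +ᵥ x ∈ C) (hne : C.Nonempty) : C = univ :=
  (eq_empty_or_univ_of_vadd_invariant_closed ℤ hC fun n =>
    vadd_set_subset_iff.2 fun x hx => hvadd n x hx).resolve_left hne.ne_empty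

theorem finite_of_vadd_eq_self [ContinuousConstVAdd ℤ α] [T1Space α] {q : ℤ} (hq : q ≠ 0) {x : α}
    (hx : q +ᵥ x = x) : Finite α := by
  have orbit_subset : ∀ n : ℤ, n +ᵥ x ∈ (fun i : ℤ => i +ᵥ x) '' Ico 0 |q| := by
    intro n
    refine ⟨n % q, ⟨Int.emod_nonneg n hq, Int.emod_lt_abs n hq⟩, ?_⟩
    have hmul : ((n / q) * q) +ᵥ x = x :=
      (AddAction.stabilizer ℤ x).zsmul_mem (show q ∈ AddAction.stabilizer ℤ x from hx) (n / q)
    conv_rhs => rw [← Int.emod_add_ediv_mul n q, add_vadd, hmul]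
  have hfin := (finite_Ico 0 |q|).image fun i : ℤ => i +ᵥ x
  refine finite_univ_iff.1 (hfin.subset fun y _ => ?_)
  refine closure_minimal ?_ hfin.isClosed (AddAction.dense_orbit ℤ x y)
  rintro _ ⟨n, rfl⟩
  exact orbit_subset n

namespace ScalesTime

variable {P Q : ℤ}

theorem forall_mem_range [ContinuousConstVAdd ℤ α] {f : α → γ} {g : β → γ}
    (hf : ScalesTime (Q * P) f) (hfc : Continuous f) (hg : ScalesTime Q g)
    (hgc : IsClosed (range g)) {x : α} (hx : f x ∈ range g) (z : α) : f z ∈ range g := by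
  suffices h : f ⁻¹' range g = univ from eq_univ_iff_forall.1 h z
  refine eq_univ_of_isClosed_of_vadd_mem (hgc.preimage hfc) ?_ ⟨x, hx⟩
  rintro n z ⟨y, hy⟩
  exact ⟨(P * n) +ᵥ y, by rw [hg, hf, hy, mul_assoc]⟩

theorem Ico_vadd_range_eq_univ [ContinuousConstVAdd ℤ α] [T2Space α] [TopologicalSpace β]
    [CompactSpace β] [Nonempty β]
    {f : β → α} (hf : ScalesTime P f) (hP : 0 < P) (hfc : Continuous f) :
    Ico 0 P +ᵥ range f = univ := by
  refine eq_univ_of_isClosed_of_vadd_mem ?_ ?_ ((nonempty_Ico.2 hP).vadd (range_nonempty f))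
  · rw [← iUnion_vadd_left_image]
    exact (finite_Ico 0 P).isClosed_biUnion fun j _ => (isCompact_range hfc).isClosed.vadd j
  · rintro n _ ⟨j, -, _, ⟨y, rfl⟩, rfl⟩
    refine mem_vadd.2 ⟨(n + j) % P, ⟨Int.emod_nonneg _ hP.ne', Int.emod_lt_of_pos _ hP⟩,
      f (((n + j) / P) +ᵥ y), mem_range_self _, ?_⟩
    rw [hf, vadd_vadd, Int.emod_add_mul_ediv, add_vadd]

/-- The range of `F` is contained in a single translate of the range of `S`, so `S` can be inverted
along `F`. -/
theorem exists_scalesTime_of_mul [ContinuousConstVAdd ℤ α] [CompactSpace α] [T2Space α]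
    {S F : α → α} (hS : ScalesTime P S) (hP : 0 < P) (hSc : Continuous S)
    (hSinj : Function.Injective S) (hF : ScalesTime (P * Q) F) (hFc : Continuous F) :
    ∃ g : α → α, Continuous g ∧ ScalesTime Q g := by
  rcases isEmpty_or_nonempty α with _ | hne
  · exact ⟨id, continuous_id, fun _ => isEmptyElim⟩
  have hx : F hne.some ∈ Ico 0 P +ᵥ range S := hS.Ico_vadd_range_eq_univ hP hSc ▸ mem_univ _
  obtain ⟨j, -, _, ⟨y, rfl⟩, hj⟩ := mem_vadd.1 hx
  have hT : ScalesTime P fun z => j +ᵥ S z := hS.const_vadd j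
  have hemb : Topology.IsClosedEmbedding fun z => j +ᵥ S z :=
    (hSc.const_vadd j).isClosedEmbedding ((AddAction.injective j).comp hSinj)
  have hval (z : α) : ∃ z', j +ᵥ S z' = F z :=
    hF.forall_mem_range hFc hT hemb.isClosed_range ⟨y, hj⟩ z
  choose g hg using hval
  refine ⟨g, hemb.continuous_iff.2 (by simpa only [Function.comp_def, hg] using hFc), ?_⟩
  intro n z
  apply hemb.injective
  calc j +ᵥ S (g (n +ᵥ z)) = (P * (Q * n)) +ᵥ F z := by rw [hg, hF, mul_assoc]
    _ = j +ᵥ S ((Q * n) +ᵥ g z) := by rw [← hg z]; exact (hT (Q * n) (g z)).symm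

end ScalesTime

theorem exists_natAbs_le_vadd_mem [ContinuousConstVAdd ℤ α] [CompactSpace α] {U : Set α}
    (hU : IsOpen U) (hne : U.Nonempty) :
    ∃ N : ℕ, ∀ x : α, ∃ i : ℤ, i.natAbs ≤ N ∧ i +ᵥ x ∈ U := by
  obtain ⟨I, hI⟩ := isCompact_univ.exists_finite_cover_vadd ℤ hU hne
  refine ⟨I.sup Int.natAbs, fun x => ?_⟩
  obtain ⟨i, hi, hx⟩ := mem_iUnion₂.1 (hI (mem_univ x))
  exact ⟨-i, by simpa using Finset.le_sup (f := Int.natAbs) hi, mem_vadd_set_iff_neg_vadd_mem.1 hx⟩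

theorem exists_natAbs_le_apply_vadd_eq [ContinuousConstVAdd ℤ α] [CompactSpace α] {D : Type*}
    [TopologicalSpace D] [DiscreteTopology D] [Finite D] {w : α → D} (hw : Continuous w)
    (hws : Function.Surjective w) :
    ∃ N : ℕ, ∀ (d : D) (x : α), ∃ i : ℤ, i.natAbs ≤ N ∧ w (i +ᵥ x) = d := by
  have hvisit (d : D) : ∃ N : ℕ, ∀ x : α, ∃ i : ℤ, i.natAbs ≤ N ∧ i +ᵥ x ∈ w ⁻¹' {d} :=
    exists_natAbs_le_vadd_mem ((isOpen_discrete {d}).preimage hw) (hws d)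
  choose N hN using hvisit
  obtain ⟨m, hm⟩ := (finite_range N).bddAbove
  refine ⟨m, fun d x => ?_⟩
  obtain ⟨i, hi, hd⟩ := hN d x
  exact ⟨i, hi.trans (hm (mem_range_self d)), hd⟩

end MinimalSystems

section Subshifts

variable {A B C : Type*} [TopologicalSpace A] [TopologicalSpace B] [TopologicalSpace C]

/-- An integer `n` acts on a subshift by the `n`-th power of the left shift. -/
instance instAddActionCarrier (X : Subshift A ℤ) : AddAction ℤ X.carrier where
  vadd n x := ⟨shift n x, X.mapsTo n x.2⟩
  zero_vadd x := Subtype.ext (shift_zero x.1)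
  add_vadd m n x := Subtype.ext (by rw [add_comm]; exact shift_add n m x.1)

theorem coe_vadd {X : Subshift A ℤ} (n : ℤ) (x : X.carrier) :
    ((n +ᵥ x : X.carrier) : ℤ → A) = shift n x :=
  rfl

instance instContinuousConstVAddCarrier (X : Subshift A ℤ) :
    ContinuousConstVAdd ℤ X.carrier :=
  ⟨fun n => ((continuous_shift n).comp continuous_subtype_val).subtype_mk _⟩

instance instCompactSpaceCarrier [Finite A] (X : Subshift A ℤ) : CompactSpace X.carrier :=
  isCompact_iff_compactSpace.1 X.isClosed.isCompact

theorem conjugate_iff_exists_scalesTime_one {X : Subshift A ℤ} {Y : Subshift B ℤ} :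
    Conjugate X Y ↔ ∃ φ : X.carrier ≃ₜ Y.carrier, ScalesTime 1 φ :=
  exists_congr fun _ => ⟨fun h => ScalesTime.of_map_one_vadd h, fun h x => h 1 x⟩

theorem Conjugate.symm {X : Subshift A ℤ} {Y : Subshift B ℤ} (h : Conjugate X Y) :
    Conjugate Y X := by
  obtain ⟨φ, hφ⟩ := conjugate_iff_exists_scalesTime_one.1 h
  exact conjugate_iff_exists_scalesTime_one.2 ⟨φ.symm, hφ.equiv_symm (e := φ.toEquiv)⟩

theorem Conjugate.trans {X : Subshift A ℤ} {Y : Subshift B ℤ} {Z : Subshift C ℤ}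
    (hXY : Conjugate X Y) (hYZ : Conjugate Y Z) : Conjugate X Z := by
  obtain ⟨φ, hφ⟩ := conjugate_iff_exists_scalesTime_one.1 hXY
  obtain ⟨ψ, hψ⟩ := conjugate_iff_exists_scalesTime_one.1 hYZ
  exact conjugate_iff_exists_scalesTime_one.2 ⟨φ.trans ψ, hψ.comp hφ⟩

theorem Conjugate.exists_scalesTime {X : Subshift A ℤ} {Y : Subshift B ℤ} (h : Conjugate X Y)
    {P : ℤ} {f : X.carrier → X.carrier} (hfc : Continuous f) (hf : ScalesTime P f) :
    ∃ F : Y.carrier → Y.carrier, Continuous F ∧ ScalesTime P F := by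
  obtain ⟨φ, hφ⟩ := conjugate_iff_exists_scalesTime_one.1 h
  have hφ' : ScalesTime 1 φ.symm := hφ.equiv_symm (e := φ.toEquiv)
  refine ⟨φ ∘ f ∘ φ.symm, φ.continuous.comp (hfc.comp φ.symm.continuous), ?_⟩
  simpa only [one_mul, mul_one] using hφ.comp (hf.comp hφ')

end Subshifts

section Words

variable {A : Type*}

/-- The word `w` occurs in the two-sided sequence `x` at position `m`. -/
def OccursAt (w : List A) (x : ℤ → A) (m : ℤ) : Prop :=
  ∀ (j : ℕ) (hj : j < w.length), x (m + j) = w[j]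

theorem occursAt_append {u v : List A} {x : ℤ → A} {m : ℤ} :
    OccursAt (u ++ v) x m ↔ OccursAt u x m ∧ OccursAt v x (m + u.length) := by
  refine ⟨fun h => ⟨fun j hj => ?_, fun j hj => ?_⟩, fun ⟨hu, hv⟩ j hj => ?_⟩
  · rw [h j (by rw [List.length_append]; lia), List.getElem_append_left hj]
  · have := h (u.length + j) (by rw [List.length_append]; lia)
    rw [List.getElem_append_right (by lia)] at this
    simpa [add_assoc] using this
  · rcases lt_or_ge j u.length with hju | hju
    · rw [List.getElem_append_left hju, hu j hju]
    · rw [List.length_append] at hj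
      rw [List.getElem_append_right hju, ← hv (j - u.length) (by lia)]
      congr 1
      lia

theorem occursAt_singleton {a : A} {x : ℤ → A} {m : ℤ} : OccursAt [a] x m ↔ x m = a := by
  simp [OccursAt]

theorem occursAt_ofFn {n : ℕ} {f : Fin n → A} {x : ℤ → A} {m : ℤ} :
    OccursAt (List.ofFn f) x m ↔ ∀ j : Fin n, x (m + (j : ℕ)) = f j := by
  simp [OccursAt, Fin.forall_iff]

theorem occursAt_shift {w : List A} {x : ℤ → A} {n m : ℤ} :
    OccursAt w (shift n x) m ↔ OccursAt w x (n + m) := by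
  simp only [OccursAt, shift_apply, add_assoc]

theorem OccursAt.eq_of_length_eq {u v : List A} {x : ℤ → A} {m : ℤ} (hu : OccursAt u x m)
    (hv : OccursAt v x m) (hlen : u.length = v.length) : u = v :=
  List.ext_getElem hlen fun j hju hjv => (hu j hju).symm.trans (hv j hjv)

theorem OccursAt.exists_of_infix {u v : List A} {x : ℤ → A} {m : ℤ} (hv : OccursAt v x m)
    (huv : u <:+: v) : ∃ m', OccursAt u x m' := by
  obtain ⟨s, t, rfl⟩ := huv
  exact ⟨_, (occursAt_append.1 (occursAt_append.1 hv).1).2⟩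

theorem WordAppears.of_infix {u v : List A} {X : Set (ℤ → A)} (hv : WordAppears v X)
    (huv : u <:+: v) : WordAppears u X := by
  obtain ⟨x, hx, m, hm⟩ := hv
  exact ⟨x, hx, OccursAt.exists_of_infix hm huv⟩

end Words

section SubstMap

variable {A : Type*} {L : ℕ} (θ : A → Fin L → A)

theorem length_iterWord (k : ℕ) (a : A) : (iterWord θ k a).length = L ^ k := by
  simp [iterWord, length_substWord_iterate]

theorem iterWord_succ (k : ℕ) (a : A) : iterWord θ (k + 1) a = substWord θ (iterWord θ k a) :=
  Function.iterate_succ_apply' _ _ _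

theorem exists_iterWord_eq_of_iterWord_succ_eq [Finite A] :
    ∃ n, ∀ a b, iterWord θ (n + 1) a = iterWord θ (n + 1) b → iterWord θ n a = iterWord θ n b := by
  let K : ℕ →o Set (A × A) :=
    { toFun n := {p | iterWord θ n p.1 = iterWord θ n p.2}
      monotone' := monotone_nat_of_le_succ fun n p hp => by
        rw [mem_ofPred_eq] at hp ⊢
        rw [iterWord_succ, iterWord_succ, hp] }
  obtain ⟨n, hn⟩ := WellFoundedGT.monotone_chain_condition K
  exact ⟨n, fun a b h => (hn (n + 1) n.le_succ).ge (show (a, b) ∈ K (n + 1) from h)⟩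

variable [NeZero L]

/-- The extension of a substitution to two-sided sequences, with `θ (x m)` placed at `L * m`. -/
def substMap (x : ℤ → A) : ℤ → A :=
  fun i => θ (x (i / L)) (Fin.ofNat L (i % L).toNat)

theorem substMap_mul_add (x : ℤ → A) (m : ℤ) (j : Fin L) :
    substMap θ x (L * m + (j : ℕ)) = θ (x m) j := by
  have hL : (L : ℤ) ≠ 0 := by exact_mod_cast NeZero.ne L
  have hj : ((j : ℕ) : ℤ) < L := by exact_mod_cast j.2
  have hj0 : (0 : ℤ) ≤ ((j : ℕ) : ℤ) := by positivity
  have hdiv : (L * m + (j : ℕ)) / (L : ℤ) = m := by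
    rw [Int.mul_add_ediv_left _ _ hL, Int.ediv_eq_zero_of_lt hj0 hj, add_zero]
  have hmod : (L * m + (j : ℕ)) % (L : ℤ) = (j : ℕ) := by
    rw [Int.mul_add_emod_self_left, Int.emod_eq_of_lt hj0 hj]
  simp only [substMap, hdiv, hmod, Int.toNat_natCast, Fin.ofNat_eq_cast, Fin.cast_val_eq_self]

theorem substMap_shift (n : ℤ) (x : ℤ → A) :
    substMap θ (shift n x) = shift (L * n) (substMap θ x) := by
  have hL : (L : ℤ) ≠ 0 := by exact_mod_cast NeZero.ne L
  funext i
  simp only [substMap, shift_apply, Int.mul_add_emod_self_left, Int.mul_add_ediv_left _ _ hL]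

theorem continuous_substMap [TopologicalSpace A] [DiscreteTopology A] :
    Continuous (substMap θ) :=
  continuous_pi fun i => (continuous_of_discreteTopology
    (f := fun a => θ a (Fin.ofNat L (i % L).toNat))).comp (continuous_apply (i / (L : ℤ)))

variable {θ}

theorem OccursAt.substMap {w : List A} {x : ℤ → A} {m : ℤ} (h : OccursAt w x m) :
    OccursAt (substWord θ w) (substMap θ x) (L * m) := by
  induction w generalizing m with
  | nil => exact fun j hj => absurd hj (by simp [substWord])
  | cons a w ih =>
    rw [← List.singleton_append, occursAt_append, occursAt_singleton] at h
    obtain ⟨ha, hw⟩ := h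
    have hcons : substWord θ (a :: w) = List.ofFn (θ a) ++ substWord θ w := by simp [substWord]
    rw [hcons, occursAt_append, occursAt_ofFn, List.length_ofFn]
    refine ⟨fun j => by rw [substMap_mul_add, ha], ?_⟩
    simpa [mul_add] using ih hw

theorem occursAt_iterWord (k : ℕ) (x : ℤ → A) (m : ℤ) :
    OccursAt (iterWord θ k (x m)) ((substMap θ)^[k] x) (L ^ k * m) := by
  induction k with
  | zero => simp [iterWord, occursAt_singleton]
  | succ k ih =>
    rw [iterWord_succ, Function.iterate_succ_apply', pow_succ', mul_assoc]
    exact ih.substMap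

theorem getElem?_iterWord (k : ℕ) (x : ℤ → A) (i : ℤ) :
    (iterWord θ k (x (i / L ^ k)))[(i % L ^ k).toNat]? = some ((substMap θ)^[k] x i) := by
  have hpos : (0 : ℤ) < L ^ k := by have := NeZero.pos L; positivity
  have hnonneg := Int.emod_nonneg i hpos.ne'
  have hlt : (i % L ^ k).toNat < (iterWord θ k (x (i / L ^ k))).length := by
    rw [length_iterWord]
    zify
    rw [Int.toNat_of_nonneg hnonneg]
    exact Int.emod_lt_of_pos i hpos
  rw [List.getElem?_eq_getElem hlt, ← occursAt_iterWord k x _ _ hlt, Int.toNat_of_nonneg hnonneg,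
    Int.mul_ediv_add_emod]

theorem iterate_substMap_eq_iff {k : ℕ} {x y : ℤ → A} :
    (substMap θ)^[k] x = (substMap θ)^[k] y ↔ ∀ n, iterWord θ k (x n) = iterWord θ k (y n) := by
  refine ⟨fun h n => ?_, fun h => funext fun i => ?_⟩
  · refine (h ▸ occursAt_iterWord k x n).eq_of_length_eq (occursAt_iterWord k y n) ?_
    rw [length_iterWord, length_iterWord]
  · exact Option.some.inj (by rw [← getElem?_iterWord, h, getElem?_iterWord])

/-- A block of `(substMap θ)^[k] z` overlaps at most two consecutive blocks of the slightly shifted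
sequence `(substMap θ)^[k] x`. -/
theorem iterWord_eq_of_iterate_substMap_eq_shift {k : ℕ} {x z : ℤ → A} {d : ℤ}
    (h : (substMap θ)^[k] z = shift d ((substMap θ)^[k] x)) (hd : |d| < L ^ k) {n n' : ℤ}
    (hx : ∀ e ∈ Icc (-1 : ℤ) 1, x (n + e) = x (n' + e)) :
    iterWord θ k (z n) = iterWord θ k (z n') := by
  have hpos : (0 : ℤ) < L ^ k := (abs_nonneg d).trans_lt hd
  refine List.ext_getElem (by rw [length_iterWord, length_iterWord]) fun j hj hj' => ?_
  rw [← occursAt_iterWord k z n j hj, ← occursAt_iterWord k z n' j hj', h]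
  have hjL : (j : ℤ) < L ^ k := by rw [length_iterWord] at hj; exact_mod_cast hj
  have he : (d + j) / L ^ k ∈ Icc (-1 : ℤ) 1 := by
    rw [abs_lt] at hd
    exact ⟨(Int.le_ediv_iff_mul_le hpos).2 (by linarith),
      Int.lt_add_one_iff.1 ((Int.ediv_lt_iff_lt_mul hpos).2 (by linarith))⟩
  have hblock (n : ℤ) : some (shift d ((substMap θ)^[k] x) (L ^ k * n + j)) =
      (iterWord θ k (x (n + (d + j) / L ^ k)))[((d + j) % L ^ k).toNat]? := by
    rw [shift_apply, ← getElem?_iterWord, show d + (L ^ k * n + j) = L ^ k * n + (d + j) by ring,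
      Int.mul_add_ediv_left _ _ hpos.ne', Int.mul_add_emod_self_left]
  exact Option.some.inj (by rw [hblock, hblock, hx _ he])

end SubstMap

section SubstSystem

variable {A : Type*} {L : ℕ} {θ : A → Fin L → A}

theorem IsPrimitive.exists_iterWord_infix (hθ : IsPrimitive θ) :
    ∃ p, ∀ i a b, iterWord θ i a <:+: iterWord θ (i + p) b := by
  obtain ⟨p, hp⟩ := hθ
  refine ⟨p, fun i a b => ?_⟩
  obtain ⟨s, t, hst⟩ := List.append_of_mem (hp b a)
  refine ⟨(substWord θ)^[i] s, (substWord θ)^[i] t, ?_⟩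
  have hadd : iterWord θ (i + p) b = (substWord θ)^[i] (iterWord θ p b) :=
    Function.iterate_add_apply _ _ _ _
  rw [hadd, hst, List.append_cons, substWord_iterate_append, substWord_iterate_append, iterWord]

variable [Finite A] [TopologicalSpace A] [DiscreteTopology A] [L.AtLeastTwo]

theorem wordAppears_iterWord (hθ : IsPrimitive θ) (i : ℕ) (a : A) :
    WordAppears (iterWord θ i a) (substSystem θ).carrier := by
  obtain ⟨k, c, u, v, hk, huv, -⟩ := exists_padded Nat.AtLeastTwo.prop θ hθ i a 0
  refine (substSystem_containsWords Nat.AtLeastTwo.prop θ hθ k c hk).of_infix ?_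
  exact ⟨u, v, by rw [huv, List.append_assoc]⟩

theorem exists_shift_substMap_eq (hθ : IsPrimitive θ) {x : ℤ → A}
    (hx : x ∈ (substSystem θ).carrier) :
    ∃ (j : ℤ) (y : ℤ → A), y ∈ (substSystem θ).carrier ∧ shift j (substMap θ y) = x := by
  have hL : (0 : ℤ) < L := by exact_mod_cast NeZero.pos L
  have hcont (j : ℤ) : Continuous fun y => shift j (substMap θ y) :=
    (continuous_shift j).comp (continuous_substMap θ)
  let Z : Subshift A ℤ :=
    { carrier := ⋃ j ∈ Ico (0 : ℤ) L, (fun y => shift j (substMap θ y)) '' (substSystem θ).carrier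
      isClosed := (finite_Ico _ _).isClosed_biUnion fun j _ =>
        ((substSystem θ).isClosed.isCompact.image (hcont j)).isClosed
      mapsTo := by
        intro n x hx
        simp only [mem_iUnion₂, mem_image] at hx ⊢
        obtain ⟨j, -, y, hy, rfl⟩ := hx
        refine ⟨(j + n) % L, ⟨Int.emod_nonneg _ hL.ne', Int.emod_lt_of_pos _ hL⟩,
          shift ((j + n) / L) y, (substSystem θ).mapsTo _ hy, ?_⟩
        rw [substMap_shift, ← shift_add, ← shift_add, Int.mul_ediv_add_emod] }
  have hZ : ContainsWords θ Z := by
    intro i a hi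
    obtain ⟨i, rfl⟩ := Nat.exists_eq_add_of_le' hi
    obtain ⟨y, hy, m, hm⟩ := wordAppears_iterWord hθ i a
    refine ⟨substMap θ y, mem_biUnion (left_mem_Ico.2 hL) ⟨y, hy, shift_zero _⟩, L * m, ?_⟩
    rw [iterWord_succ]
    exact OccursAt.substMap hm
  obtain ⟨j, -, y, hy, hyx⟩ := mem_iUnion₂.1 (substSystem_subset θ Z hZ hx)
  exact ⟨j, y, hy, hyx⟩

theorem exists_occursAt_iterWord (hθ : IsPrimitive θ) {x : ℤ → A}
    (hx : x ∈ (substSystem θ).carrier) (k : ℕ) : ∃ b m, OccursAt (iterWord θ k b) x m := by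
  induction k generalizing x with
  | zero => exact ⟨x 0, 0, occursAt_singleton.2 rfl⟩
  | succ k ih =>
    obtain ⟨j, y, hy, rfl⟩ := exists_shift_substMap_eq hθ hx
    obtain ⟨b, m, hm⟩ := ih hy
    refine ⟨b, L * m - j, occursAt_shift.2 ?_⟩
    rw [add_sub_cancel, iterWord_succ]
    exact hm.substMap

theorem isMinimal_substSystem (hθ : IsPrimitive θ) :
    AddAction.IsMinimal ℤ (substSystem θ).carrier := by
  refine (isMinimal_iff_isClosed_vadd_invariant ℤ).2 fun C hC hinv => ?_
  rcases C.eq_empty_or_nonempty with hempty | ⟨x, hx⟩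
  · exact Or.inl hempty
  let Y : Subshift A ℤ :=
    { carrier := Subtype.val '' C
      isClosed := (substSystem θ).isClosed.isClosedEmbedding_subtypeVal.isClosedMap C hC
      mapsTo := by
        rintro n _ ⟨y, hy, rfl⟩
        exact ⟨n +ᵥ y, hinv n (vadd_mem_vadd_set hy), rfl⟩ }
  obtain ⟨p, hp⟩ := hθ.exists_iterWord_infix
  have hY : ContainsWords θ Y := fun i a _ => by
    obtain ⟨b, m, hm⟩ := exists_occursAt_iterWord hθ x.2 (i + p)
    exact WordAppears.of_infix ⟨x, mem_image_of_mem _ hx, m, hm⟩ (hp i a b)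
  refine Or.inr (eq_univ_of_forall fun y => ?_)
  exact Subtype.val_injective.mem_set_image.1 (substSystem_subset θ Y hY y.2)

theorem mapsTo_substMap_substSystem (hθ : IsPrimitive θ) :
    MapsTo (substMap θ) (substSystem θ).carrier (substSystem θ).carrier := by
  have := isMinimal_substSystem hθ
  intro x hx
  obtain ⟨j, y, hy, hyx⟩ := exists_shift_substMap_eq hθ hx
  suffices h : {z : (substSystem θ).carrier | substMap θ z ∈ (substSystem θ).carrier} = univ from
    eq_univ_iff_forall.1 h ⟨x, hx⟩
  refine eq_univ_of_isClosed_of_vadd_mem ?_ ?_ ⟨⟨y, hy⟩, ?_⟩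
  · exact (substSystem θ).isClosed.preimage ((continuous_substMap θ).comp continuous_subtype_val)
  · intro n z hz
    rw [mem_ofPred_eq, coe_vadd, substMap_shift]
    exact (substSystem θ).mapsTo _ hz
  · have := (substSystem θ).mapsTo (-j) hx
    rwa [← hyx, ← shift_add, add_neg_cancel, shift_zero] at this

end SubstSystem

theorem exists_mul_pow_lt_pow (c : ℕ) {a b : ℕ} (hab : a < b) : ∃ k, c * a ^ k < b ^ k := by
  rcases Nat.eq_zero_or_pos a with rfl | ha
  · exact ⟨1, by simpa using hab⟩
  have hratio : (1 : ℚ) < b / a := (one_lt_div (by exact_mod_cast ha)).2 (by exact_mod_cast hab)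
  obtain ⟨k, hk⟩ := pow_unbounded_of_one_lt (c : ℚ) hratio
  rw [div_pow, lt_div_iff₀ (by positivity)] at hk
  exact ⟨k, by exact_mod_cast hk⟩

theorem card_Ico_pow (L k : ℕ) : (Finset.Ico 0 ((L : ℤ) ^ k)).card = L ^ k := by
  rw [Int.card_Ico, sub_zero]
  exact_mod_cast Int.toNat_natCast (L ^ k)

section Recognizability

variable {A : Type*} [TopologicalSpace A] {L : ℕ} [NeZero L] {θ : A → Fin L → A}
  {X : Subshift A ℤ} (hm : MapsTo (substMap θ) X.carrier X.carrier)

/-- The self-map of a subshift `X` induced by a substitution that maps `X` to itself. -/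
def inducedMap : X.carrier → X.carrier :=
  hm.restrict

theorem coe_iterate_inducedMap (k : ℕ) (x : X.carrier) :
    ((inducedMap hm)^[k] x : ℤ → A) = (substMap θ)^[k] x :=
  hm.coe_iterate_restrict x k

theorem scalesTime_inducedMap : ScalesTime L (inducedMap hm) := fun n x =>
  Subtype.ext (substMap_shift θ n x)

theorem iterate_inducedMap_eq_iff {k : ℕ} {x y : X.carrier} :
    (inducedMap hm)^[k] x = (inducedMap hm)^[k] y ↔
      ∀ n, iterWord θ k (x.1 n) = iterWord θ k (y.1 n) := by
  rw [Subtype.ext_iff, coe_iterate_inducedMap, coe_iterate_inducedMap, iterate_substMap_eq_iff]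

variable [DiscreteTopology A]

theorem continuous_inducedMap : Continuous (inducedMap hm) :=
  (continuous_substMap θ).restrict hm

variable [Finite A] [AddAction.IsMinimal ℤ X.carrier] {k : ℕ}

/-- The `L ^ k` points `i +ᵥ θ^k(x₀)` are distinct, and each of them is `t +ᵥ θ^k(z)` for some
`t ∈ J` and some `z` that matters only through its letters at one representative position of each
`3`-letter window of `x₀`. -/
theorem pow_le_card_mul_card_of_vadd_range_eq_univ [Infinite X.carrier] {J : Finset ℤ}
    (hJ : J ⊆ Finset.Ico 0 (L ^ k)) (hcov : (J : Set ℤ) +ᵥ range (inducedMap hm)^[k] = univ) :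
    L ^ k ≤ J.card * Nat.card ((Icc (-1 : ℤ) 1 → A) → A) := by
  obtain ⟨x₀⟩ : Nonempty X.carrier := inferInstance
  have hphase (i : ℤ) : ∃ t ∈ J, ∃ z, t +ᵥ (inducedMap hm)^[k] z = i +ᵥ (inducedMap hm)^[k] x₀ := by
    obtain ⟨t, ht, _, ⟨z, rfl⟩, h⟩ := mem_vadd.1 (hcov ▸ mem_univ (i +ᵥ (inducedMap hm)^[k] x₀))
    exact ⟨t, ht, z, h⟩
  choose t ht z hz using hphase
  let window (n : ℤ) (e : Icc (-1 : ℤ) 1) : A := x₀.1 (n + e)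
  let rep : (Icc (-1 : ℤ) 1 → A) → ℤ := Function.invFun window
  have hrep (n : ℤ) : window (rep (window n)) = window n := Function.invFun_eq ⟨n, rfl⟩
  have hlocal (i : Finset.Ico (0 : ℤ) (L ^ k)) (n : ℤ) :
      iterWord θ k ((z i).1 n) = iterWord θ k ((z i).1 (rep (window n))) := by
    have hi := Finset.mem_Ico.1 i.2
    have hti := Finset.mem_Ico.1 (hJ (ht i))
    refine iterWord_eq_of_iterate_substMap_eq_shift (x := x₀) (d := i - t i) ?_
      (abs_lt.2 ⟨by linarith, by linarith⟩) fun e he => (congrFun (hrep n) ⟨e, he⟩).symm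
    rw [← coe_iterate_inducedMap hm, ← coe_iterate_inducedMap hm, ← coe_vadd,
      sub_eq_neg_add, add_vadd, ← hz, neg_vadd_vadd]
  let code (i : Finset.Ico (0 : ℤ) (L ^ k)) : J × ((Icc (-1 : ℤ) 1 → A) → A) :=
    (⟨t i, ht i⟩, fun w => (z i).1 (rep w))
  have hcode : Function.Injective code := by
    intro i i' h
    have ht' : t i = t i' := congrArg (fun c => c.1.1) h
    have hz' (w) : (z i).1 (rep w) = (z i').1 (rep w) := congrFun (congrArg Prod.snd h) w
    have hT : (inducedMap hm)^[k] (z i) = (inducedMap hm)^[k] (z i') :=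
      (iterate_inducedMap_eq_iff hm).2 fun n => by rw [hlocal i, hz', ← hlocal i']
    by_contra hne
    refine not_finite_iff_infinite.2 ‹Infinite X.carrier› (finite_of_vadd_eq_self
      (q := -i' + i) (x := (inducedMap hm)^[k] x₀) (fun h0 => hne (Subtype.ext (by lia))) ?_)
    rw [add_vadd, ← hz, hT, ht', hz, neg_vadd_vadd]
  have hcard := Nat.card_le_card_of_injective code hcode
  rwa [Nat.card_prod, Nat.card_eq_finsetCard, Nat.card_eq_finsetCard, card_Ico_pow] at hcard

theorem pow_le_card_of_vadd_range_eq_univ [Infinite X.carrier] {I : Finset ℤ}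
    (hI : I ⊆ Finset.Ico 0 (L ^ k)) (hcov : (I : Set ℤ) +ᵥ range (inducedMap hm)^[k] = univ) :
    L ^ k ≤ I.card := by
  by_contra! hlt
  obtain ⟨e, he⟩ := exists_mul_pow_lt_pow (Nat.card ((Icc (-1 : ℤ) 1 → A) → A)) hlt
  obtain ⟨J, hJ, hcard, hJcov⟩ :=
    ((scalesTime_inducedMap hm).iterate k).exists_iterate_cover hI hcov e
  rw [← Function.iterate_mul] at hJcov
  rw [← pow_mul] at hJ he
  have hle := pow_le_card_mul_card_of_vadd_range_eq_univ hm hJ hJcov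
  exact absurd (hle.trans (Nat.mul_le_mul_right _ hcard)) (by rwa [not_le, mul_comm])

theorem Ico_vadd_range_iterate_inducedMap [Nonempty X.carrier] :
    Ico 0 ((L : ℤ) ^ k) +ᵥ range (inducedMap hm)^[k] = univ :=
  ((scalesTime_inducedMap hm).iterate k).Ico_vadd_range_eq_univ
    (pow_pos (by exact_mod_cast NeZero.pos L) k) ((continuous_inducedMap hm).iterate k)

/-- Translates of the range of `(inducedMap hm)^[k]` that meet coincide, so if they met for `j ≠ j'`
then one of the `L ^ k` translates could be left out of the covering of `X`. -/
theorem eq_of_vadd_iterate_inducedMap_eq [Infinite X.carrier] {x y : X.carrier} {j j' : ℤ}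
    (hj : j ∈ Finset.Ico 0 ((L : ℤ) ^ k)) (hj' : j' ∈ Finset.Ico 0 ((L : ℤ) ^ k))
    (h : j +ᵥ (inducedMap hm)^[k] x = j' +ᵥ (inducedMap hm)^[k] y) : j = j' := by
  by_contra hne
  have hT := (scalesTime_inducedMap hm).iterate k
  have hTc := (continuous_inducedMap hm).iterate k
  have hrange (z : X.carrier) :
      j' +ᵥ (inducedMap hm)^[k] z ∈ range fun x => j +ᵥ (inducedMap hm)^[k] x := by
    refine ScalesTime.forall_mem_range (P := 1) (x := y) ?_ (hTc.const_vadd j') (hT.const_vadd j)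
      (isCompact_range (hTc.const_vadd j)).isClosed ⟨x, h⟩ z
    rw [mul_one]
    exact hT.const_vadd j'
  have hcov : ((Finset.Ico 0 ((L : ℤ) ^ k)).erase j' : Set ℤ) +ᵥ range (inducedMap hm)^[k] =
      univ := by
    refine eq_univ_of_forall fun x => ?_
    obtain ⟨i, hi, _, ⟨z, rfl⟩, rfl⟩ :=
      mem_vadd.1 (Ico_vadd_range_iterate_inducedMap hm (k := k) ▸ mem_univ x)
    rcases eq_or_ne i j' with rfl | hij'
    · obtain ⟨z', hz'⟩ := hrange z
      exact mem_vadd.2 ⟨j, by simpa [hne] using hj, _, mem_range_self z', hz'⟩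
    · exact mem_vadd.2 ⟨i, by simpa [hij'] using hi, _, mem_range_self z, rfl⟩
  have hle := pow_le_card_of_vadd_range_eq_univ hm (Finset.erase_subset _ _) hcov
  have hlt := Finset.card_erase_lt_of_mem hj'
  exact absurd (card_Ico_pow L k ▸ hlt) hle.not_gt

theorem injective_inducedMap [Infinite X.carrier] : Function.Injective (inducedMap hm) := by
  intro x y hxy
  obtain ⟨n, hn⟩ := exists_iterWord_eq_of_iterWord_succ_eq θ
  have hcov := Ico_vadd_range_iterate_inducedMap hm (k := n)
  obtain ⟨j, hj, _, ⟨x', rfl⟩, rfl⟩ := mem_vadd.1 (hcov ▸ mem_univ x)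
  obtain ⟨j', hj', _, ⟨y', rfl⟩, rfl⟩ := mem_vadd.1 (hcov ▸ mem_univ y)
  rw [scalesTime_inducedMap hm, scalesTime_inducedMap hm,
    ← Function.iterate_succ_apply' (inducedMap hm), ← Function.iterate_succ_apply' (inducedMap hm)]
    at hxy
  have hL : (0 : ℤ) < L := by exact_mod_cast NeZero.pos L
  have hmem {i : ℤ} (hi : i ∈ Ico 0 ((L : ℤ) ^ n)) : L * i ∈ Finset.Ico 0 ((L : ℤ) ^ (n + 1)) := by
    rw [Finset.mem_Ico, pow_succ']
    exact ⟨mul_nonneg hL.le hi.1, mul_lt_mul_of_pos_left hi.2 hL⟩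
  have hjj' : (L : ℤ) * j = L * j' := eq_of_vadd_iterate_inducedMap_eq hm (hmem hj) (hmem hj') hxy
  rw [hjj', vadd_left_cancel_iff, iterate_inducedMap_eq_iff] at hxy
  rw [mul_left_cancel₀ hL.ne' hjj',
    (iterate_inducedMap_eq_iff hm).2 fun m => hn _ _ (hxy m)]

end Recognizability

section Itinerary

variable {α D : Type*} [AddAction ℤ α]

/-- The two-sided sequence of values of the observable `w` along the orbit of `x`. -/
def itinerary (w : α → D) (x : α) : ℤ → D :=
  fun i => w (i +ᵥ x)

theorem itinerary_vadd (w : α → D) (n : ℤ) (x : α) :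
    itinerary w (n +ᵥ x) = shift n (itinerary w x) := by
  funext i
  rw [shift_apply, itinerary, itinerary, vadd_vadd, add_comm]

theorem continuous_itinerary [TopologicalSpace α] [ContinuousConstVAdd ℤ α] [TopologicalSpace D]
    {w : α → D} (hw : Continuous w) : Continuous (itinerary w) :=
  continuous_pi fun i => hw.comp (continuous_const_vadd i)

theorem exists_semiconj_itinerary {R : ℕ} [NeZero R] {w : α → D} (hw : Function.Surjective w)
    {g : α → α} (hg : ScalesTime R g)
    (hdet : ∀ x y, w x = w y → ∀ j ∈ Ico (0 : ℤ) R, w (j +ᵥ g x) = w (j +ᵥ g y)) :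
    ∃ ξ : D → Fin R → D, Function.Semiconj (itinerary w) g (substMap ξ) := by
  refine ⟨fun d j => w (((j : ℕ) : ℤ) +ᵥ g (Function.surjInv hw d)), fun x => funext fun i => ?_⟩
  have hR : (0 : ℤ) < R := by exact_mod_cast NeZero.pos R
  have hmod := Int.emod_nonneg i hR.ne'
  have hlt := Int.emod_lt_of_pos i hR
  have hcast : ((Fin.ofNat R (i % R).toNat : ℕ) : ℤ) = i % R := by
    rw [Fin.val_ofNat, Nat.mod_eq_of_lt (by lia), Int.toNat_of_nonneg hmod]
  calc w (i +ᵥ g x) = w ((i % R) +ᵥ g ((i / R) +ᵥ x)) := by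
        rw [hg, vadd_vadd, Int.emod_add_mul_ediv]
    _ = w ((i % R) +ᵥ g (Function.surjInv hw (w ((i / R) +ᵥ x)))) :=
        hdet _ _ (Function.surjInv_eq hw _).symm _ ⟨hmod, hlt⟩
    _ = substMap _ (itinerary w x) i := by simp only [substMap, itinerary, hcast]

variable {R : ℕ} {w : α → D} {g : α → α} {ξ : D → Fin R → D}

theorem occursAt_iterWord_itinerary [NeZero R]
    (hξ : Function.Semiconj (itinerary w) g (substMap ξ)) (k : ℕ) (x : α) :
    OccursAt (iterWord ξ k (w x)) (itinerary w (g^[k] x)) 0 := by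
  have h := occursAt_iterWord (θ := ξ) k (itinerary w x) 0
  rwa [← hξ.iterate_right k x, mul_zero, itinerary, zero_vadd] at h

variable [TopologicalSpace α] [ContinuousConstVAdd ℤ α] [CompactSpace α] [AddAction.IsMinimal ℤ α]
  [Finite D] [TopologicalSpace D] [DiscreteTopology D] [R.AtLeastTwo]

theorem isPrimitive_of_semiconj_itinerary (hw : Continuous w) (hws : Function.Surjective w)
    (hξ : Function.Semiconj (itinerary w) g (substMap ξ)) : IsPrimitive ξ := by
  obtain ⟨N, hN⟩ := exists_natAbs_le_apply_vadd_eq hw hws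
  obtain ⟨k, hk⟩ := pow_unbounded_of_one_lt (2 * N) (Nat.AtLeastTwo.one_lt (n := R))
  refine ⟨k, fun a b => ?_⟩
  obtain ⟨x, rfl⟩ := hws a
  obtain ⟨i, hi, rfl⟩ := hN b ((N : ℤ) +ᵥ g^[k] x)
  have hj : (i + N).toNat < (iterWord ξ k (w x)).length := by rw [length_iterWord]; lia
  have hocc := occursAt_iterWord_itinerary hξ k x _ hj
  rw [Int.toNat_of_nonneg (by lia), zero_add, itinerary, ← vadd_vadd] at hocc
  exact hocc ▸ List.getElem_mem hj

theorem substSystem_carrier_eq_range_itinerary (hw : Continuous w) (hws : Function.Surjective w)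
    (hξ : Function.Semiconj (itinerary w) g (substMap ξ)) :
    (substSystem ξ).carrier = range (itinerary w) := by
  have hcont := continuous_itinerary hw
  let Y : Subshift D ℤ :=
    { carrier := range (itinerary w)
      isClosed := (isCompact_range hcont).isClosed
      mapsTo := by
        rintro n _ ⟨x, rfl⟩
        exact ⟨n +ᵥ x, itinerary_vadd w n x⟩ }
  have hsub : (substSystem ξ).carrier ⊆ range (itinerary w) :=
    substSystem_subset ξ Y fun i a _ => by
      obtain ⟨x, rfl⟩ := hws a
      exact ⟨_, mem_range_self (g^[i] x), 0, occursAt_iterWord_itinerary hξ i x⟩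
  refine hsub.antisymm ?_
  rintro _ ⟨x, rfl⟩
  obtain ⟨y, hy, -⟩ := wordAppears_iterWord (isPrimitive_of_semiconj_itinerary hw hws hξ) 0 (w x)
  obtain ⟨x', rfl⟩ := hsub hy
  suffices h : itinerary w ⁻¹' (substSystem ξ).carrier = univ from eq_univ_iff_forall.1 h x
  refine eq_univ_of_isClosed_of_vadd_mem ((substSystem ξ).isClosed.preimage hcont) ?_ ⟨x', hy⟩
  intro n z hz
  rw [mem_preimage, itinerary_vadd]
  exact (substSystem ξ).mapsTo n hz

end Itinerary

theorem conjugate_substSystem_of_injective_itinerary {A D : Type*} [TopologicalSpace A] [Finite A]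
    {X : Subshift A ℤ} [AddAction.IsMinimal ℤ X.carrier] [Finite D] [TopologicalSpace D]
    [DiscreteTopology D] {R : ℕ} [R.AtLeastTwo] {w : X.carrier → D} {g : X.carrier → X.carrier}
    {ξ : D → Fin R → D} (hw : Continuous w) (hws : Function.Surjective w)
    (hinj : Function.Injective (itinerary w))
    (hξ : Function.Semiconj (itinerary w) g (substMap ξ)) : Conjugate (substSystem ξ) X := by
  have hemb := ((continuous_itinerary hw).isClosedEmbedding hinj).isEmbedding
  have hrange := substSystem_carrier_eq_range_itinerary hw hws hξ
  refine Conjugate.symm (conjugate_iff_exists_scalesTime_one.2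
    ⟨hemb.toHomeomorph.trans (Homeomorph.setCongr hrange.symm), fun n x => Subtype.ext ?_⟩)
  rw [one_mul]
  exact itinerary_vadd w n x

theorem exists_continuous_surjective_fin {α C : Type*} [TopologicalSpace α] [TopologicalSpace C]
    [DiscreteTopology C] [Finite C] {v : α → C} (hv : Continuous v) :
    ∃ (k : ℕ) (w : α → Fin k), Continuous w ∧ Function.Surjective w ∧
      ∀ x y, w x = w y ↔ v x = v y := by
  let e := Finite.equivFin (range v)
  refine ⟨_, e ∘ rangeFactorization v, ?_, e.surjective.comp rangeFactorization_surjective,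
    fun x y => ?_⟩
  · exact continuous_of_discreteTopology.comp hv.rangeFactorization
  · rw [Function.comp_apply, Function.comp_apply, e.apply_eq_iff_eq, Subtype.ext_iff]
    rfl

theorem exists_finset_forall_eqOn_imp_eq {ι A D : Type*} [TopologicalSpace A] [DiscreteTopology A]
    [TopologicalSpace D] [DiscreteTopology D] {K : Set (ι → A)} [CompactSpace K] {F : K → D}
    (hF : Continuous F) : ∃ U : Finset ι, ∀ x y : K, EqOn x.1 y.1 U → F x = F y := by
  classical
  have hlocal (x : K) : ∃ U : Finset ι, Subtype.val ⁻¹' cylinder U x.1 ⊆ F ⁻¹' {F x} := by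
    obtain ⟨V, hV, hVF⟩ := isOpen_induced_iff.1 ((isOpen_discrete {F x}).preimage hF)
    have hxV : x ∈ Subtype.val ⁻¹' V := hVF.ge rfl
    obtain ⟨U, u, hu, hUV⟩ := isOpen_pi_iff.1 hV x.1 hxV
    exact ⟨U, fun y hy => hVF.le (hUV fun i hi => (hy i hi).symm ▸ (hu i hi).2)⟩
  choose U hU using hlocal
  obtain ⟨t, ht⟩ := CompactSpace.elim_nhds_subcover
    (fun x : K => Subtype.val ⁻¹' cylinder (U x) x.1)
    fun x => ((isOpen_cylinder _ _).preimage continuous_subtype_val).mem_nhds fun _ _ => rfl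
  refine ⟨t.biUnion U, fun x y hxy => ?_⟩
  obtain ⟨z, hz, hxz⟩ := mem_iUnion₂.1 (ht.ge (mem_univ x))
  have hyz : y.1 ∈ cylinder (U z) z.1 := fun i hi =>
    (hxy (Finset.mem_biUnion.2 ⟨z, hz, hi⟩)).symm.trans (hxz i hi)
  exact (hU z hxz).trans (hU z hyz).symm

section TimeScalingSelfMap

variable {A : Type*} [TopologicalSpace A] {X : Subshift A ℤ} {g : X.carrier → X.carrier} {R : ℕ}

theorem exists_eqOn_Icc_imp_eqOn_Ico [DiscreteTopology A] [Finite A] (hg : Continuous g) (R : ℕ) :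
    ∃ s : ℕ, ∀ x y : X.carrier,
      EqOn x.1 y.1 (Icc (-s : ℤ) s) → EqOn (g x).1 (g y).1 (Ico 0 R) := by
  have hF : Continuous fun (x : X.carrier) (j : Fin R) => (g x).1 (j : ℕ) :=
    continuous_pi fun j => (continuous_apply _).comp (continuous_subtype_val.comp hg)
  obtain ⟨U, hU⟩ := exists_finset_forall_eqOn_imp_eq hF
  refine ⟨U.sup Int.natAbs, fun x y hxy j hj => ?_⟩
  have hsub : (U : Set ℤ) ⊆ Icc (-(U.sup Int.natAbs : ℕ) : ℤ) (U.sup Int.natAbs : ℕ) := by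
    intro i hi
    have := Finset.le_sup (f := Int.natAbs) hi
    exact ⟨by lia, by lia⟩
  obtain ⟨j, rfl⟩ := Int.eq_ofNat_of_zero_le hj.1
  exact congrFun (hU x y (hxy.mono hsub)) ⟨j, by exact_mod_cast hj.2⟩

theorem eqOn_vadd_of_eqOn {s : ℤ} (hR : 2 ≤ R) (hg : ScalesTime R g)
    (hs : ∀ x y : X.carrier, EqOn x.1 y.1 (Icc (-s) s) → EqOn (g x).1 (g y).1 (Ico 0 R))
    {x y : X.carrier} (hxy : EqOn x.1 y.1 (Icc (-(2 * s)) (2 * s))) {j : ℤ}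
    (hj : j ∈ Ico (0 : ℤ) R) :
    EqOn (j +ᵥ g x).1 (j +ᵥ g y).1 (Icc (-(2 * s)) (2 * s)) := by
  rintro i ⟨hi0, hi1⟩
  have hRpos : (0 : ℤ) < R := by exact_mod_cast pos_of_gt hR
  have hR' : (2 : ℤ) ≤ R := by exact_mod_cast hR
  have hmod := Int.emod_nonneg (j + i) hRpos.ne'
  have hlt := Int.emod_lt_of_pos (j + i) hRpos
  have hq := Int.emod_add_mul_ediv (j + i) R
  have hcoord (z : X.carrier) :
      (j +ᵥ g z).1 i = (g (((j + i) / R) +ᵥ z)).1 ((j + i) % R) := by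
    rw [hg, coe_vadd, coe_vadd, shift_apply, shift_apply, add_comm (_ * _), hq]
  rw [hcoord, hcoord]
  refine hs (_ +ᵥ x) (_ +ᵥ y) (fun l hl => ?_) ⟨hmod, hlt⟩
  rw [coe_vadd, coe_vadd, shift_apply, shift_apply]
  have h2s : 2 * s ≤ R * s := mul_le_mul_of_nonneg_right hR' (by linarith)
  have hupper : R * ((j + i) / R) < R * (s + 1) := by linarith [hj.2]
  have hlower : R * (-s - 1) < R * ((j + i) / R) := by linarith [hj.1]
  have hle := lt_of_mul_lt_mul_left hupper hRpos.le
  have hge := lt_of_mul_lt_mul_left hlower hRpos.le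
  obtain ⟨hl0, hl1⟩ := hl
  exact hxy ⟨by lia, by lia⟩

theorem exists_substSystem_conjugate_of_scalesTime [DiscreteTopology A] [Finite A]
    [AddAction.IsMinimal ℤ X.carrier] (hR : 2 ≤ R) (hgc : Continuous g) (hg : ScalesTime R g) :
    ∃ (k : ℕ) (ξ : Fin k → Fin R → Fin k), IsPrimitive ξ ∧ Conjugate (substSystem ξ) X := by
  have : R.AtLeastTwo := ⟨hR⟩
  obtain ⟨s, hs⟩ := exists_eqOn_Icc_imp_eqOn_Ico hgc R
  let v (x : X.carrier) (i : Icc (-(2 * s : ℤ)) (2 * s)) : A := x.1 i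
  have hv : Continuous v :=
    continuous_pi fun i => (continuous_apply _).comp continuous_subtype_val
  have hv_iff (x y : X.carrier) : v x = v y ↔ EqOn x.1 y.1 (Icc (-(2 * s : ℤ)) (2 * s)) := by
    simp only [v, funext_iff, Subtype.forall, EqOn]
  obtain ⟨k, w, hw, hws, hwv⟩ := exists_continuous_surjective_fin hv
  have hdet (x y) (hxy : w x = w y) (j : ℤ) (hj : j ∈ Ico (0 : ℤ) R) :
      w (j +ᵥ g x) = w (j +ᵥ g y) := by
    rw [hwv, hv_iff] at hxy ⊢
    exact eqOn_vadd_of_eqOn hR hg hs hxy hj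
  have hinj : Function.Injective (itinerary w) := fun x y hxy => Subtype.ext <| funext fun i => by
    have hi := (hv_iff _ _).1 ((hwv _ _).1 (congrFun hxy i)) (x := 0) ⟨by simp, by simp⟩
    simpa only [coe_vadd, shift_apply, add_zero] using hi
  obtain ⟨ξ, hξ⟩ := exists_semiconj_itinerary hws hg hdet
  exact ⟨k, ξ, isPrimitive_of_semiconj_itinerary hw hws hξ,
    conjugate_substSystem_of_injective_itinerary hw hws hinj hξ⟩

end TimeScalingSelfMap

theorem exists_substSystem_conjugate_of_scalesTime_mul {B : Type*} [TopologicalSpace B]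
    [DiscreteTopology B] [Finite B] {N R : ℕ} [N.AtLeastTwo] {ζ : B → Fin N → B}
    (hζ : IsPrimitive ζ) [Infinite (substSystem ζ).carrier] (hR : 2 ≤ R)
    {F : (substSystem ζ).carrier → (substSystem ζ).carrier} (hFc : Continuous F)
    (hF : ScalesTime (N * R) F) :
    ∃ (k : ℕ) (ξ : Fin k → Fin R → Fin k),
      IsPrimitive ξ ∧ Conjugate (substSystem ξ) (substSystem ζ) := by
  have := isMinimal_substSystem hζ
  have hm := mapsTo_substMap_substSystem hζ
  obtain ⟨g, hgc, hg⟩ := (scalesTime_inducedMap hm).exists_scalesTime_of_mul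
    (by exact_mod_cast NeZero.pos N) (continuous_inducedMap hm) (injective_inducedMap hm) hF hFc
  exact exists_substSystem_conjugate_of_scalesTime hR hgc hg

end ConstLength

theorem mainTheorem2 {A B : Type*}
    [Finite A] [TopologicalSpace A] [DiscreteTopology A]
    [Finite B] [TopologicalSpace B] [DiscreteTopology B]
    {M N R : ℕ} (hM : 2 ≤ M) (hN : 2 ≤ N)
    (θ : A → Fin M → A) (ζ : B → Fin N → B)
    (hθ : ConstLength.IsPrimitive θ) (hζ : ConstLength.IsPrimitive ζ)
    (hθinf : (ConstLength.substSystem θ).carrier.Infinite)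
    (hζinf : (ConstLength.substSystem ζ).carrier.Infinite)
    (hconj : ConstLength.Conjugate (ConstLength.substSystem θ) (ConstLength.substSystem ζ))
    (hMN : M = R * N) (hR : 1 < R) :
    ∃ (k : ℕ) (ξ : Fin k → Fin R → Fin k),
      ConstLength.IsPrimitive ξ ∧
      ConstLength.Conjugate (ConstLength.substSystem ξ) (ConstLength.substSystem θ) ∧
      ConstLength.Conjugate (ConstLength.substSystem ξ) (ConstLength.substSystem ζ) := by
  have : M.AtLeastTwo := ⟨hM⟩
  have : N.AtLeastTwo := ⟨hN⟩
  have := hζinf.to_subtype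
  have hθmap := ConstLength.mapsTo_substMap_substSystem hθ
  obtain ⟨F, hFc, hF⟩ := hconj.exists_scalesTime (ConstLength.continuous_inducedMap hθmap)
    (ConstLength.scalesTime_inducedMap hθmap)
  have hMN' : (M : ℤ) = N * R := by rw [hMN, Nat.cast_mul, mul_comm]
  obtain ⟨k, ξ, hξ, hξζ⟩ :=
    ConstLength.exists_substSystem_conjugate_of_scalesTime_mul hζ hR hFc (hMN' ▸ hF)
  exact ⟨k, ξ, hξ, hξζ.trans hconj.symm, hξζ⟩
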